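/- Let $k$ be a field of characteristic zero, let $d\ge 2$, and let $P\in k[X,Y_1]$ be a polynomial such that $P(0,Y_1)\in k[Y_1]$ has degree at least $2$ (for example $P=\prod_{i=1}^r (Y_1-\sigma_i(X))$ with $r\ge 2$ and $\sigma_i\in k[X]$, the standard form). Let $$B_{d,P}=k[X,Y_1,Y_2]/\bigl(X^dY_2-P(X,Y_1)\bigr)$$ be the corresponding generalised Danielewski surface, and let $y_1,y_2$ be the images of $Y_1,Y_2$ in $B_{d,P}$. Let $\delta$ be a locally nilpotent $k$-derivation of $B_{d,P}$, let $\alpha$ be a $k$-algebra automorphism of $B_{d,P}$, and let $\mathrm{Aut}(\delta)$ be the group of all $k$-algebra automorphisms $\theta$ of $B_{d,P}$ with $\theta\delta=\delta\theta$. Then the following are equivalent: (i) $\alpha\in\mathrm{Aut}(\delta)$; (ii) $\delta\alpha(y_1)=\alpha\delta(y_1)$; (iii) $\delta\alpha(y_2)=\alpha\delta(y_2)$. -/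

import Mathlib

open Polynomial

noncomputable section

namespace Danielewski

/-- A derivation `δ` of a `k`-algebra `B` is locally nilpotent if every element of `B` is
annihilated by some iterate of `δ`. -/
def IsLocallyNilpotent {k B : Type*} [CommRing k] [CommRing B] [Algebra k B]
    (δ : Derivation k B B) : Prop :=
  ∀ b : B, ∃ n : ℕ, (⇑δ)^[n] b = 0

/-- The isotropy subgroup `Aut(δ)` of a derivation `δ`: the `k`-algebra automorphisms `α` of `B`
with `α δ = δ α`. -/
def isotropySubgroup {k B : Type*} [CommRing k] [CommRing B] [Algebra k B]
    (δ : Derivation k B B) : Subgroup (B ≃ₐ[k] B) where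
  carrier := {α | ∀ b : B, α (δ b) = δ (α b)}
  mul_mem' := by
    intro α β hα hβ b
    change α (β (δ b)) = δ (α (β b))
    rw [hβ b, hα (β b)]
  one_mem' := by
    intro b
    rfl
  inv_mem' := by
    intro α hα b
    change α.symm (δ b) = δ (α.symm b)
    rw [AlgEquiv.symm_apply_eq, hα, AlgEquiv.apply_symm_apply]

/-- The image in `k[X, Y₁, Y₂]` of a polynomial `P ∈ k[X][Y₁]`; the variables
`X, Y₁, Y₂` are the ones with index `0, 1, 2`. -/
def toThree {k : Type*} [Field k] (P : k[X][X]) : MvPolynomial (Fin 3) k :=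
  P.eval₂ (Polynomial.aeval (MvPolynomial.X 0 : MvPolynomial (Fin 3) k)).toRingHom
    (MvPolynomial.X 1)

/-- The `k`-algebra `B_{d,P} = k[X, Y₁, Y₂] / (X ^ d * Y₂ - P(X, Y₁))`. -/
abbrev Surface {k : Type*} [Field k] (d : ℕ) (P : k[X][X]) : Type _ :=
  MvPolynomial (Fin 3) k ⧸
    Ideal.span {(MvPolynomial.X 0 ^ d * MvPolynomial.X 2 - toThree P : MvPolynomial (Fin 3) k)}

/-- The image `y₁` of `Y₁` in `B_{d,P}`. -/
def y₁ {k : Type*} [Field k] (d : ℕ) (P : k[X][X]) : Surface d P :=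
  Ideal.Quotient.mk _ (MvPolynomial.X 1)

/-- The image `y₂` of `Y₂` in `B_{d,P}`. -/
def y₂ {k : Type*} [Field k] (d : ℕ) (P : k[X][X]) : Surface d P :=
  Ideal.Quotient.mk _ (MvPolynomial.X 2)

end Danielewski

end

/-! The key fact is that every locally nilpotent derivation of `B_{d,P}` kills `x`
(`IsLocallyNilpotent.apply_xCoord`). It applies to `δ` and to `α⁻¹δα`, so their difference `Δ` kills
`x`. Inside `k[y][x, x⁻¹]` this gives `Δ = Δ(y₁) ∂/∂y`, whence `Δ(y₂) = Δ(y₁) x⁻ᵈ ∂P/∂y`. As `∂P/∂y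
≠ 0`, `Δ` vanishes as soon as it kills `y₁` or `y₂` (`derivation_eq_zero_tfae`).

To see that `δ x = 0`, filter `B_{d,P}` by the order in `x`, and let `p = P(0, y)`. The lowest part
of `δ` is a derivation `xᵉ (a x ∂/∂x + b ∂/∂y)`, nilpotent on the leading forms, and comparing
degrees forces `a = 0` (`eq_zero_of_homogeneous_nilpotent`). If `δ x ≠ 0`, the kernel contains a
nonconstant `f` (`exists_nonconstant_mem_ker`). Its leading coefficient is killed by `b ∂/∂y`, hence
lies in `k`. This forces `f ∈ k[x, y]` with `f - r` divisible by `x` for some scalar `r`. Kernels of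
locally nilpotent derivations are factorially closed, so `δ x = 0` after all. -/

noncomputable section

namespace Danielewski

/-! ### Degree function of a locally nilpotent derivation. -/

section DerivationDegree

variable {k A : Type*} [CommRing k] [CommRing A] [Algebra k A]

/-- `f` has degree `n` with respect to the derivation `D`. -/
def HasDeg (D : Derivation k A A) (f : A) (n : ℕ) : Prop :=
  (⇑D)^[n] f ≠ 0 ∧ (⇑D)^[n + 1] f = 0

theorem iterate_map_zero (D : Derivation k A A) (n : ℕ) : (⇑D)^[n] (0 : A) = 0 :=
  Function.iterate_fixed (map_zero D) n

theorem iterate_map_add (D : Derivation k A A) (n : ℕ) (f g : A) :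
    (⇑D)^[n] (f + g) = (⇑D)^[n] f + (⇑D)^[n] g := by
  induction n generalizing f g with
  | zero => rfl
  | succ n ih => simp only [Function.iterate_succ_apply, map_add, ih]

theorem iterate_mul_of_apply_eq_zero (D : Derivation k A A) {f : A} (hf : D f = 0) (m : ℕ)
    (g : A) : (⇑D)^[m] (f * g) = f * (⇑D)^[m] g := by
  induction m generalizing g with
  | zero => rfl
  | succ m ih => simp [Function.iterate_succ_apply, hf, ih]

/-- Only one term of the Leibniz expansion survives. Its binomial coefficient is nonzero in
characteristic zero, which makes degrees additive on a domain. -/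
theorem iterate_mul (D : Derivation k A A) (N : ℕ) : ∀ (n m : ℕ) (f g : A), n + m = N →
    (⇑D)^[n + 1] f = 0 → (⇑D)^[m + 1] g = 0 →
    (⇑D)^[n + m] (f * g) = ((n + m).choose n : A) * ((⇑D)^[n] f * (⇑D)^[m] g) := by
  induction N with
  | zero =>
    intro n m f g h _ _
    obtain ⟨rfl, rfl⟩ : n = 0 ∧ m = 0 := by omega
    simp
  | succ N ih =>
    intro n m f g h hf hg
    rcases n with _ | n
    · simpa using iterate_mul_of_apply_eq_zero D hf m g
    rcases m with _ | m
    · have := iterate_mul_of_apply_eq_zero D hg (n + 1) f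
      rw [mul_comm] at this
      simpa [mul_comm] using this
    have h1 := ih n (m + 1) (D f) g (by omega) (by simpa [Function.iterate_succ_apply] using hf) hg
    have h2 := ih (n + 1) m f (D g) (by omega) hf (by simpa [Function.iterate_succ_apply] using hg)
    have e1 : n + 1 + (m + 1) = (n + (m + 1)) + 1 := by omega
    have e2 : n + 1 + m = n + (m + 1) := by omega
    rw [e2] at h2
    rw [e1, Function.iterate_succ_apply, Derivation.leibniz, iterate_map_add, smul_eq_mul,
      smul_eq_mul, h2, mul_comm g, h1, Nat.choose_succ_succ]
    simp only [Function.iterate_succ_apply]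
    push_cast
    ring

theorem HasDeg.unique {D : Derivation k A A} {f : A} {n m : ℕ} (hn : HasDeg D f n)
    (hm : HasDeg D f m) : n = m := by
  have aux : ∀ {n m : ℕ}, HasDeg D f n → HasDeg D f m → ¬ n < m := by
    intro n m hn hm h
    obtain ⟨j, rfl⟩ := Nat.exists_eq_add_of_lt h
    apply hm.1
    rw [show n + j + 1 = j + (n + 1) by omega, Function.iterate_add_apply, hn.2, iterate_map_zero]
  have := aux hn hm
  have := aux hm hn
  omega

theorem exists_hasDeg {D : Derivation k A A} {f : A} (hf : f ≠ 0)
    (h : ∃ n, (⇑D)^[n] f = 0) : ∃ n, HasDeg D f n := by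
  classical
  rcases hN : Nat.find h with _ | n
  · exact absurd (by simpa [hN] using Nat.find_spec h) hf
  · exact ⟨n, Nat.find_min h (by omega), hN ▸ Nat.find_spec h⟩

theorem HasDeg.apply {D : Derivation k A A} {f : A} {n : ℕ} (h : HasDeg D f n) (hf : D f ≠ 0) :
    ∃ m, n = m + 1 ∧ HasDeg D (D f) m := by
  rcases n with _ | m
  · exact absurd h.2 hf
  · exact ⟨m, rfl, h.1, h.2⟩

theorem HasDeg.ne_zero {D : Derivation k A A} {f : A} {n : ℕ} (h : HasDeg D f n) : f ≠ 0 := by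
  rintro rfl
  exact h.1 (iterate_map_zero D n)

theorem HasDeg.apply_eq_zero {D : Derivation k A A} {f : A} (h : HasDeg D f 0) : D f = 0 := h.2

variable [IsDomain A] [CharZero A]

theorem HasDeg.mul {D : Derivation k A A} {f g : A} {n m : ℕ} (hf : HasDeg D f n)
    (hg : HasDeg D g m) : HasDeg D (f * g) (n + m) := by
  constructor
  · rw [iterate_mul D _ n m f g rfl hf.2 hg.2]
    refine mul_ne_zero ?_ (mul_ne_zero hf.1 hg.1)
    exact_mod_cast (Nat.choose_pos (by omega)).ne'
  · rw [show n + m + 1 = n + 1 + m by omega, iterate_mul D _ (n + 1) m f g rfl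
      (by rw [Function.iterate_succ_apply', hf.2, map_zero]) hg.2, hf.2]
    simp

theorem HasDeg.pow {D : Derivation k A A} {f : A} {n : ℕ} (hf : HasDeg D f n) (j : ℕ) :
    HasDeg D (f ^ j) (j * n) := by
  induction j with
  | zero => simp [HasDeg]
  | succ j ih => simpa [pow_succ, Nat.succ_mul] using ih.mul hf

/-- A locally nilpotent element dividing its derivative is a constant. -/
theorem apply_eq_zero_of_eq_mul {D : Derivation k A A} {f q : A} (hf : ∃ n, (⇑D)^[n] f = 0)
    (hq : ∃ n, (⇑D)^[n] q = 0) (h : D f = f * q) : D f = 0 := by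
  by_contra h0
  have hf0 : f ≠ 0 := fun h1 => h0 (by simp [h1])
  have hq0 : q ≠ 0 := fun h1 => h0 (by simp [h, h1])
  obtain ⟨n, hn⟩ := exists_hasDeg hf0 hf
  obtain ⟨m, hm⟩ := exists_hasDeg hq0 hq
  obtain ⟨j, rfl, hj⟩ := hn.apply h0
  -- `D` lowers the degree by one, whereas multiplication by `q` cannot lower it.
  have := hj.unique (h ▸ hn.mul hm)
  omega

/-- The kernel of a locally nilpotent derivation is factorially closed. -/
theorem apply_eq_zero_of_mul {D : Derivation k A A} {f q : A} (hf : ∃ n, (⇑D)^[n] f = 0)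
    (hq : ∃ n, (⇑D)^[n] q = 0) (h0 : f * q ≠ 0) (h : D (f * q) = 0) : D f = 0 := by
  obtain ⟨n, hn⟩ := exists_hasDeg (left_ne_zero_of_mul h0) hf
  obtain ⟨m, hm⟩ := exists_hasDeg (right_ne_zero_of_mul h0) hq
  have : n + m = 0 := (hn.mul hm).unique ⟨h0, h⟩
  obtain ⟨rfl, rfl⟩ : n = 0 ∧ m = 0 := by omega
  exact hn.apply_eq_zero

end DerivationDegree

/-! ### Derivations and lowest terms in `k[y][T;T⁻¹]`. -/

section Laurent

open LaurentPolynomial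

variable {k : Type*} [Field k]

/-- The derivation of `k[y][T;T⁻¹]` sending `r * Tⁿ` to `L n r * Tⁿ`. -/
def gradedDerivation (L : ℤ → k[X] →ₗ[k] k[X])
    (hL : ∀ n m a b, L (n + m) (a * b) = a * L m b + b * L n a) :
    Derivation k k[X][T;T⁻¹] k[X][T;T⁻¹] :=
  Derivation.mk'
    { toFun := fun f => f.coeff.sum fun n r => .single n (L n r)
      map_add' := by
        intro f g
        rw [AddMonoidAlgebra.coeff_add, Finsupp.sum_add_index']
        · simp
        · simp
      map_smul' := by
        intro c f
        rw [AddMonoidAlgebra.coeff_smul, Finsupp.sum_smul_index' (by simp), Finsupp.sum,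
          Finsupp.sum, RingHom.id_apply, Finset.smul_sum]
        refine Finset.sum_congr rfl fun n _ => ?_
        rw [map_smul, AddMonoidAlgebra.smul_single] }
    (by
      intro f g
      induction f using LaurentPolynomial.induction_on' with
      | add f f' hf hf' => simp only [add_mul, map_add, hf, hf', smul_eq_mul]; ring
      | C_mul_T n a =>
        induction g using LaurentPolynomial.induction_on' with
        | add g g' hg hg' => simp only [mul_add, map_add, hg, hg', smul_eq_mul]; ring
        | C_mul_T m b =>
          simp only [← single_eq_C_mul_T, AddMonoidAlgebra.single_mul_single, LinearMap.coe_mk,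
            AddHom.coe_mk, AddMonoidAlgebra.coeff_single, smul_eq_mul]
          rw [Finsupp.sum_single_index (by simp), Finsupp.sum_single_index (by simp),
            Finsupp.sum_single_index (by simp), AddMonoidAlgebra.single_mul_single,
            AddMonoidAlgebra.single_mul_single, hL, AddMonoidAlgebra.single_add, add_comm m n])

theorem gradedDerivation_C_mul_T (L : ℤ → k[X] →ₗ[k] k[X])
    (hL : ∀ n m a b, L (n + m) (a * b) = a * L m b + b * L n a) (c : k[X]) (n : ℤ) :
    gradedDerivation L hL (LaurentPolynomial.C c * T n) = LaurentPolynomial.C (L n c) * T n := by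
  simp only [← single_eq_C_mul_T]
  exact Finsupp.sum_single_index (h := fun n r => AddMonoidAlgebra.single n (L n r)) (by simp)

/-- The Euler derivation `T d/dT` of `k[y][T;T⁻¹]`. -/
def euler : Derivation k k[X][T;T⁻¹] k[X][T;T⁻¹] :=
  gradedDerivation (fun n => LinearMap.mulLeft k (n : k[X])) (by
    intro n m a b
    simp only [LinearMap.mulLeft_apply]
    push_cast
    ring)

/-- The coefficientwise derivative `d/dy` of `k[y][T;T⁻¹]`. -/
def coeffDeriv : Derivation k k[X][T;T⁻¹] k[X][T;T⁻¹] :=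
  gradedDerivation (fun _ => derivative) (by
    intro n m a b
    rw [derivative_mul]
    ring)

theorem euler_C_mul_T (c : k[X]) (n : ℤ) :
    euler (LaurentPolynomial.C c * T n) = LaurentPolynomial.C (n * c) * T n := by
  rw [euler, gradedDerivation_C_mul_T]
  simp

theorem coeffDeriv_C_mul_T (c : k[X]) (n : ℤ) :
    coeffDeriv (LaurentPolynomial.C c * T n) = LaurentPolynomial.C (derivative c) * T n := by
  rw [coeffDeriv, gradedDerivation_C_mul_T]

/-- `f` has no terms of `T`-degree less than `n`, and `c` is its coefficient in degree `n`. -/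
def HasLead (n : ℤ) (f : k[X][T;T⁻¹]) (c : k[X]) : Prop :=
  ∃ g : k[X][X], f = T n * toLaurent g ∧ g.coeff 0 = c

theorem hasLead_toLaurent (g : k[X][X]) : HasLead 0 (toLaurent g) (g.coeff 0) :=
  ⟨g, by simp, rfl⟩

theorem hasLead_C_mul_T (c : k[X]) (n : ℤ) : HasLead n (LaurentPolynomial.C c * T n) c :=
  ⟨Polynomial.C c, by rw [Polynomial.toLaurent_C, mul_comm], by simp⟩

theorem hasLead_T (n : ℤ) : HasLead n (T n : k[X][T;T⁻¹]) 1 := by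
  simpa using hasLead_C_mul_T (1 : k[X]) n

theorem HasLead.mul {n m : ℤ} {f g : k[X][T;T⁻¹]} {a b : k[X]} (hf : HasLead n f a)
    (hg : HasLead m g b) : HasLead (n + m) (f * g) (a * b) := by
  obtain ⟨u, rfl, rfl⟩ := hf
  obtain ⟨v, rfl, rfl⟩ := hg
  exact ⟨u * v, by rw [T_add, map_mul]; ring, mul_coeff_zero u v⟩

theorem HasLead.pow {n : ℤ} {f : k[X][T;T⁻¹]} {a : k[X]} (hf : HasLead n f a) (l : ℕ) :
    HasLead (l * n) (f ^ l) (a ^ l) := by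
  induction l with
  | zero => simpa using hasLead_T (k := k) 0
  | succ l ih =>
    rw [pow_succ, pow_succ]
    convert ih.mul hf using 1
    push_cast
    ring

theorem HasLead.add {n : ℤ} {f g : k[X][T;T⁻¹]} {a b : k[X]} (hf : HasLead n f a)
    (hg : HasLead n g b) : HasLead n (f + g) (a + b) := by
  obtain ⟨u, rfl, rfl⟩ := hf
  obtain ⟨v, rfl, rfl⟩ := hg
  exact ⟨u + v, by rw [map_add]; ring, coeff_add u v 0⟩

/-- A lead is allowed to vanish, so `n` is only a lower bound for the order; this lets elements of
different orders be compared at a common degree. -/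
theorem HasLead.of_lt {n m : ℤ} {f : k[X][T;T⁻¹]} {a : k[X]} (hf : HasLead n f a) (h : m < n) :
    HasLead m f 0 := by
  obtain ⟨u, rfl, rfl⟩ := hf
  obtain ⟨j, rfl⟩ := Int.exists_add_of_le (Int.add_one_le_of_lt h)
  refine ⟨X ^ (j + 1) * u, ?_, by simp [mul_coeff_zero]⟩
  rw [map_mul, Polynomial.toLaurent_X_pow, ← mul_assoc, ← T_add]
  push_cast
  ring_nf

theorem eq_T_neg_mul_of_eq_T_mul {n : ℤ} {f g : k[X][T;T⁻¹]} (h : f = T n * g) :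
    g = T (-n) * f := by
  rw [h, ← mul_assoc, ← T_add]
  simp

theorem HasLead.unique {n : ℤ} {f : k[X][T;T⁻¹]} {a b : k[X]} (hf : HasLead n f a)
    (hg : HasLead n f b) : a = b := by
  obtain ⟨u, hu, rfl⟩ := hf
  obtain ⟨v, hv, rfl⟩ := hg
  have := (eq_T_neg_mul_of_eq_T_mul hu).trans (eq_T_neg_mul_of_eq_T_mul hv).symm
  rw [toLaurent_injective this]

theorem hasLead_zero (n : ℤ) : HasLead n (0 : k[X][T;T⁻¹]) 0 := ⟨0, by simp, by simp⟩

theorem HasLead.sub {n : ℤ} {f g : k[X][T;T⁻¹]} {a b : k[X]} (hf : HasLead n f a)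
    (hg : HasLead n g b) : HasLead n (f - g) (a - b) := by
  obtain ⟨u, rfl, rfl⟩ := hf
  obtain ⟨v, rfl, rfl⟩ := hg
  exact ⟨u - v, by rw [map_sub]; ring, coeff_sub u v 0⟩

theorem exists_hasLead {f : k[X][T;T⁻¹]} (hf : f ≠ 0) : ∃ n c, c ≠ 0 ∧ HasLead n f c := by
  obtain ⟨n, g, hg⟩ := exists_T_pow f
  have hg0 : g ≠ 0 := by
    rintro rfl
    rw [map_zero] at hg
    exact hf (((isUnit_T (R := k[X]) (n : ℤ)).mul_left_eq_zero).1 hg.symm)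
  obtain ⟨h, hh, hd⟩ := exists_eq_pow_rootMultiplicity_mul_and_not_dvd g hg0 0
  rw [map_zero, sub_zero] at hh hd
  set m := rootMultiplicity 0 g
  refine ⟨m - n, h.coeff 0, fun h0 => hd (X_dvd_iff.2 h0), h, ?_, rfl⟩
  have : f = T (-n) * toLaurent g := eq_T_neg_mul_of_eq_T_mul (by rw [hg, mul_comm])
  rw [this, hh, map_mul, Polynomial.toLaurent_X_pow, ← mul_assoc, ← T_add]
  ring_nf

theorem hasLead_gradedDerivation (L : ℤ → k[X] →ₗ[k] k[X])
    (hL : ∀ n m a b, L (n + m) (a * b) = a * L m b + b * L n a) {n : ℤ} {f : k[X][T;T⁻¹]}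
    {c : k[X]} (hf : HasLead n f c) : HasLead n (gradedDerivation L hL f) (L n c) := by
  obtain ⟨g, rfl, rfl⟩ := hf
  induction g using Polynomial.induction_on' with
  | add p q hp hq =>
    rw [map_add, mul_add, map_add, coeff_add, map_add]
    exact hp.add hq
  | monomial m r =>
    rw [← C_mul_X_pow_eq_monomial, Polynomial.toLaurent_C_mul_X_pow, mul_left_comm, ← T_add,
      gradedDerivation_C_mul_T]
    rcases m with _ | m
    · simpa using hasLead_C_mul_T (L n r) n
    · have := (hasLead_C_mul_T (L (n + (m + 1 : ℕ)) r) (n + (m + 1 : ℕ))).of_lt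
        (m := n) (by push_cast; omega)
      simpa using this

theorem HasLead.euler {n : ℤ} {f : k[X][T;T⁻¹]} {c : k[X]} (hf : HasLead n f c) :
    HasLead n (euler f) (n * c) := by
  have := hasLead_gradedDerivation (fun n => LinearMap.mulLeft k (n : k[X])) (by
    intro n m a b
    simp only [LinearMap.mulLeft_apply]
    push_cast
    ring) hf
  simpa [Danielewski.euler] using this

theorem HasLead.coeffDeriv {n : ℤ} {f : k[X][T;T⁻¹]} {c : k[X]} (hf : HasLead n f c) :
    HasLead n (coeffDeriv f) (derivative c) :=
  hasLead_gradedDerivation (fun _ => derivative) _ hf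

theorem charZero_of_algebra {A : Type*} [Ring A] [Nontrivial A] [Algebra k A] [CharZero k] :
    CharZero A :=
  charZero_of_injective_algebraMap (algebraMap k A).injective

end Laurent

/-! ### Embedding of `B_{d,P}` and the possible leading coefficients. -/

section Embedding

open LaurentPolynomial

variable {k : Type*} [Field k] (d : ℕ) (P : k[X][X])

/-- The image `x` of `X` in `B_{d,P}`. -/
def xCoord : Surface d P :=
  Ideal.Quotient.mk _ (MvPolynomial.X 0)

/-- The natural map `k[y][x] → B_{d,P}`. -/
def toSurface : k[X][X] →ₐ[k] Surface d P :=
  Polynomial.eval₂AlgHom (aeval (y₁ d P)) (xCoord d P) fun _ => Commute.all _ _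

/-- The polynomial `P(X, Y₁)` as an element of `k[Y₁][X]`. -/
def swapVars : k[X][X] :=
  P.eval₂ (aeval (X : k[X][X])).toRingHom (Polynomial.C X)

theorem toSurface_X : toSurface d P X = xCoord d P := by
  simp [toSurface]

theorem toSurface_C (c : k[X]) : toSurface d P (Polynomial.C c) = aeval (y₁ d P) c := by
  simp [toSurface]

theorem coeff_zero_swapVars : (swapVars P).coeff 0 = P.map (evalRingHom (0 : k)) := by
  rw [← constantCoeff_apply, swapVars, hom_eval₂, constantCoeff_apply, coeff_C_zero,
    ← eval₂_C_X (p := P.map (evalRingHom (0 : k))), eval₂_map]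
  congr 1
  refine Polynomial.ringHom_ext (fun a => ?_) ?_
  · simp [Polynomial.algebraMap_apply]
  · simp

theorem xCoord_pow_mul_y₂ : xCoord d P ^ d * y₂ d P = toSurface d P (swapVars P) := by
  have h : xCoord d P ^ d * y₂ d P - Ideal.Quotient.mk _ (toThree P) = 0 := by
    rw [xCoord, y₂, ← map_pow, ← map_mul, ← map_sub]
    exact Ideal.Quotient.eq_zero_iff_mem.2 (Ideal.mem_span_singleton_self _)
  have h' : Ideal.Quotient.mk (Ideal.span {MvPolynomial.X 0 ^ d * MvPolynomial.X 2 - toThree P})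
      (toThree P) = P.eval₂ ((Ideal.Quotient.mk _).comp
        (aeval (MvPolynomial.X 0 : MvPolynomial (Fin 3) k)).toRingHom) (y₁ d P) :=
    hom_eval₂ _ _ _ _
  rw [sub_eq_zero.1 h, h', swapVars, ← AlgHom.coe_toRingHom, hom_eval₂]
  congr 1
  · refine Polynomial.ringHom_ext (fun a => ?_) ?_
    · have h0 : (Ideal.Quotient.mk _ (MvPolynomial.C a) : Surface d P) = algebraMap k _ a := rfl
      simp [toSurface_C, h0]
    · simp [toSurface, xCoord]
  · simp [toSurface, y₁]

/-- The embedding of `B_{d,P}` into `k[y][x, x⁻¹]`. -/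
def toLaurentRing : Surface d P →ₐ[k] k[X][T;T⁻¹] :=
  Ideal.Quotient.liftₐ _
    (MvPolynomial.aeval ![T 1, LaurentPolynomial.C X, T (-d) * toLaurent (swapVars P)]) (by
      intro a ha
      obtain ⟨c, rfl⟩ := Ideal.mem_span_singleton.1 ha
      rw [map_mul]
      convert zero_mul _
      rw [map_sub, map_mul, map_pow, MvPolynomial.aeval_X, MvPolynomial.aeval_X, toThree, swapVars,
        ← AlgHom.coe_toRingHom, hom_eval₂, hom_eval₂, sub_eq_zero]
      simp only [Matrix.cons_val, T_pow, ← mul_assoc, ← T_add]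
      rw [show ((d : ℤ) * 1 + -d) = 0 by ring, T_zero, one_mul]
      congr 1
      · refine Polynomial.ringHom_ext (fun a => ?_) ?_
        · simp
        · simp
      · simp)

theorem toLaurentRing_xCoord : toLaurentRing d P (xCoord d P) = T 1 := by
  exact (MvPolynomial.aeval_X _ 0).trans rfl

theorem toLaurentRing_y₁ : toLaurentRing d P (y₁ d P) = LaurentPolynomial.C X := by
  exact (MvPolynomial.aeval_X _ 1).trans rfl

theorem toLaurentRing_y₂ : toLaurentRing d P (y₂ d P) = T (-d) * toLaurent (swapVars P) := by
  exact (MvPolynomial.aeval_X _ 2).trans rfl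

theorem toLaurentRing_toSurface (g : k[X][X]) :
    toLaurentRing d P (toSurface d P g) = toLaurent g := by
  have : (toLaurentRing d P).toRingHom.comp (toSurface d P).toRingHom = toLaurent := by
    refine Polynomial.ringHom_ext' (Polynomial.ringHom_ext (fun a => ?_) ?_) ?_
    · simp [toSurface_C]
    · simp [toSurface_C, toLaurentRing_y₁]
    · simp [toSurface_X, toLaurentRing_xCoord]
  exact congrArg (fun f : k[X][X] →+* k[X][T;T⁻¹] => f g) this

theorem exists_eval₂_eq (b : Surface d P) :
    ∃ Q : k[X][X][X], Q.eval₂ (toSurface d P).toRingHom (y₂ d P) = b := by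
  obtain ⟨f, rfl⟩ := Ideal.Quotient.mk_surjective b
  induction f using MvPolynomial.induction_on with
  | C a =>
    refine ⟨Polynomial.C (Polynomial.C (Polynomial.C a)), ?_⟩
    simp [toSurface_C]
    rfl
  | add p q hp hq =>
    obtain ⟨u, hu⟩ := hp
    obtain ⟨v, hv⟩ := hq
    exact ⟨u + v, by rw [eval₂_add, hu, hv, map_add]⟩
  | mul_X p i hp =>
    obtain ⟨u, hu⟩ := hp
    fin_cases i
    · exact ⟨u * Polynomial.C X, by
        rw [eval₂_mul, hu, map_mul, Polynomial.eval₂_C]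
        congr 1
        exact toSurface_X d P⟩
    · exact ⟨u * Polynomial.C (Polynomial.C X), by
        rw [eval₂_mul, hu, map_mul, Polynomial.eval₂_C]
        congr 1
        exact (toSurface_C d P X).trans (aeval_X _)⟩
    · exact ⟨u * X, by
        rw [eval₂_mul, hu, map_mul, eval₂_X]
        rfl⟩

/-- Lowest terms cannot cancel over the domain `k[y]`, so multiplying by a `G` of order zero
preserves the order. -/
theorem HasLead.of_mul {G : k[X][X]} (hG : G.coeff 0 ≠ 0) {n : ℤ} {β : k[X][T;T⁻¹]} {c : k[X]}
    (h : HasLead n (β * toLaurent G) c) : ∃ c', HasLead n β c' ∧ c = c' * G.coeff 0 := by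
  suffices H : ∃ c', HasLead n β c' by
    obtain ⟨c', hc'⟩ := H
    refine ⟨c', hc', h.unique ?_⟩
    simpa using hc'.mul (hasLead_toLaurent G)
  by_cases hβ : β = 0
  · exact ⟨0, hβ ▸ hasLead_zero n⟩
  obtain ⟨m, a, ha, hm⟩ := exists_hasLead hβ
  rcases lt_trichotomy m n with hmn | rfl | hmn
  · have h1 := h.of_lt hmn
    have h2 := hm.mul (hasLead_toLaurent G)
    rw [add_zero] at h2
    exact absurd (h2.unique h1) (mul_ne_zero ha hG)
  · exact ⟨a, hm⟩
  · exact ⟨0, hm.of_lt hmn⟩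

variable {d P}

theorem toLaurentRing_eval₂ (Q : k[X][X][X]) :
    toLaurentRing d P (Q.eval₂ (toSurface d P).toRingHom (y₂ d P)) =
      toLaurentRing d P (Q.divX.eval₂ (toSurface d P).toRingHom (y₂ d P)) *
        (T (-d) * toLaurent (swapVars P)) + toLaurent (Q.coeff 0) := by
  conv_lhs => rw [← Q.divX_mul_X_add]
  rw [eval₂_add, eval₂_mul, eval₂_X, Polynomial.eval₂_C, map_add, map_mul, toLaurentRing_y₂]
  congr 1
  exact toLaurentRing_toSurface d P _

theorem T_mul_toLaurentRing_divX (Q : k[X][X][X]) {f : k[X][T;T⁻¹]}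
    (h : toLaurentRing d P (Q.eval₂ (toSurface d P).toRingHom (y₂ d P)) = f) :
    toLaurentRing d P (Q.divX.eval₂ (toSurface d P).toRingHom (y₂ d P)) *
      toLaurent (swapVars P) = T d * (f - toLaurent (Q.coeff 0)) := by
  have h2 : (T d * T (-d) : k[X][T;T⁻¹]) = 1 := by rw [← T_add]; simp
  rw [← h, toLaurentRing_eval₂ Q, add_sub_cancel_right, mul_left_comm, ← mul_assoc (T _) (T _), h2,
    one_mul]

/-- Write `b = b' y₂ + u` with `u ∈ k[x, y]`. For `l ≥ 1` the bound makes `n` negative, so `u` does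
not reach degree `n` and the lead comes from `b' y₂`. Removing `y₂`, whose lead is `p T⁻ᵈ`, strips
one factor `p` and raises `n` by `d`. -/
theorem pow_dvd_of_hasLead_aux (hp : P.map (evalRingHom (0 : k)) ≠ 0) (N : ℕ) :
    ∀ (Q : k[X][X][X]), Q.natDegree ≤ N → ∀ (n : ℤ) (l : ℕ) (c : k[X]),
      HasLead n (toLaurentRing d P (Q.eval₂ (toSurface d P).toRingHom (y₂ d P))) c →
      n + d * l < d → P.map (evalRingHom (0 : k)) ^ l ∣ c := by
  induction N with
  | zero =>
    intro Q hQ n l c hc hn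
    rcases l with _ | l
    · simp
    rw [eq_C_of_natDegree_le_zero hQ, Polynomial.eval₂_C] at hc
    have h1 := hasLead_toLaurent (Q.coeff 0)
    rw [← toLaurentRing_toSurface d P] at h1
    have hn0 : n < 0 := by
      push_cast at hn
      nlinarith [mul_nonneg (Int.natCast_nonneg d) (Int.natCast_nonneg l)]
    rw [hc.unique (h1.of_lt hn0)]
    exact dvd_zero _
  | succ N ih =>
    intro Q hQ n l c hc hn
    rcases l with _ | l
    · simp
    have hn0 : n < 0 := by
      push_cast at hn
      nlinarith [mul_nonneg (Int.natCast_nonneg d) (Int.natCast_nonneg l)]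
    have h1 := (hasLead_T (k := k) d).mul (hc.sub ((hasLead_toLaurent (Q.coeff 0)).of_lt hn0))
    rw [← T_mul_toLaurentRing_divX Q rfl] at h1
    obtain ⟨c', hc', he⟩ := h1.of_mul (by rwa [coeff_zero_swapVars])
    have h2 := ih Q.divX (by rw [natDegree_divX_eq_natDegree_tsub_one]; omega) _ l _ hc'
      (by push_cast at hn; linarith)
    rw [one_mul, sub_zero, coeff_zero_swapVars] at he
    rw [he, pow_succ]
    exact mul_dvd_mul_right h2 _

theorem pow_dvd_of_hasLead (hp : P.map (evalRingHom (0 : k)) ≠ 0) {b : Surface d P} {n : ℤ}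
    {c : k[X]} (h : HasLead n (toLaurentRing d P b) c) (l : ℕ) (hn : n + d * l < d) :
    P.map (evalRingHom (0 : k)) ^ l ∣ c := by
  obtain ⟨Q, rfl⟩ := exists_eval₂_eq d P b
  exact pow_dvd_of_hasLead_aux hp _ Q le_rfl n l c h hn

/-- If `b' y₂ + u` is a polynomial in `x, y`, then `xᵈ` divides `b' P`, hence `b'`, because `P(0, y)
≠ 0`. By induction `b'` is `xᵈ` times a polynomial, and `xᵈ y₂ = P` removes `y₂`. -/
theorem eq_toSurface_aux (hp : P.map (evalRingHom (0 : k)) ≠ 0) (N : ℕ) :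
    ∀ (Q : k[X][X][X]), Q.natDegree ≤ N → ∀ g : k[X][X],
      toLaurentRing d P (Q.eval₂ (toSurface d P).toRingHom (y₂ d P)) = toLaurent g →
      Q.eval₂ (toSurface d P).toRingHom (y₂ d P) = toSurface d P g := by
  have base : ∀ u v : k[X][X], toLaurentRing d P (toSurface d P u) = toLaurent v → u = v := by
    intro u v h
    rw [toLaurentRing_toSurface] at h
    exact toLaurent_injective h
  induction N with
  | zero =>
    intro Q hQ g h
    rw [eq_C_of_natDegree_le_zero hQ, Polynomial.eval₂_C] at h ⊢
    exact congrArg (toSurface d P) (base _ _ h)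
  | succ N ih =>
    intro Q hQ g h
    have h1 := (hasLead_T (k := k) d).mul (hasLead_toLaurent (g - Q.coeff 0))
    rw [map_sub, ← T_mul_toLaurentRing_divX Q h, add_zero] at h1
    obtain ⟨c', ⟨u, hu, -⟩, -⟩ := h1.of_mul (by rwa [coeff_zero_swapVars])
    have h2 := ih Q.divX (by rw [natDegree_divX_eq_natDegree_tsub_one]; omega) (X ^ d * u)
      (by rw [hu, map_mul, toLaurent_X_pow])
    have h3 : Q.eval₂ (toSurface d P).toRingHom (y₂ d P) =
        toSurface d P (u * swapVars P + Q.coeff 0) := by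
      conv_lhs => rw [← Q.divX_mul_X_add]
      rw [eval₂_add, eval₂_mul, eval₂_X, Polynomial.eval₂_C, h2, map_mul, map_pow, toSurface_X, map_add,
        map_mul, ← xCoord_pow_mul_y₂]
      change _ + toSurface d P (Q.coeff 0) = _
      ring
    rw [h3] at h ⊢
    exact congrArg (toSurface d P) (base _ _ h)

theorem eq_toSurface (hp : P.map (evalRingHom (0 : k)) ≠ 0) {b : Surface d P} {g : k[X][X]}
    (h : toLaurentRing d P b = toLaurent g) : b = toSurface d P g := by
  obtain ⟨Q, rfl⟩ := exists_eval₂_eq d P b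
  exact eq_toSurface_aux hp _ Q le_rfl g h

theorem toLaurentRing_injective (hp : P.map (evalRingHom (0 : k)) ≠ 0) :
    Function.Injective (toLaurentRing d P) := by
  refine (injective_iff_map_eq_zero _).2 fun b hb => ?_
  rw [eq_toSurface hp (b := b) (g := 0) (by rw [hb, map_zero]), map_zero]

theorem isDomain_surface (hp : P.map (evalRingHom (0 : k)) ≠ 0) : IsDomain (Surface d P) :=
  (toLaurentRing_injective hp).isDomain (toLaurentRing d P).toRingHom

end Embedding

/-! ### Homogeneous locally nilpotent derivations. -/

section GradedDerivation

open LaurentPolynomial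

variable {k : Type*} [Field k]

/-- The homogeneous derivation `Tᵉ (a T d/dT + b d/dy)` of `k[y][T;T⁻¹]`. -/
def homogeneousDerivation (e : ℤ) (a b : k[X]) : Derivation k k[X][T;T⁻¹] k[X][T;T⁻¹] :=
  (T e * LaurentPolynomial.C a) • euler + (T e * LaurentPolynomial.C b) • coeffDeriv

theorem homogeneousDerivation_C_mul_T (e : ℤ) (a b c : k[X]) (n : ℤ) :
    homogeneousDerivation e a b (LaurentPolynomial.C c * T n) =
      LaurentPolynomial.C (n * a * c + b * derivative c) * T (n + e) := by
  simp only [homogeneousDerivation, Derivation.add_apply, Derivation.smul_apply, smul_eq_mul,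
    euler_C_mul_T, coeffDeriv_C_mul_T, T_add, map_add, map_mul]
  ring

theorem C_mul_T_eq_zero_iff {c : k[X]} {n : ℤ} :
    (LaurentPolynomial.C c * T n : k[X][T;T⁻¹]) = 0 ↔ c = 0 := by
  refine ⟨fun h => ?_, fun h => by simp [h]⟩
  exact (hasLead_C_mul_T c n).unique (h ▸ hasLead_zero n)

theorem C_mul_T_mul (a b : k[X]) (n m : ℤ) :
    (LaurentPolynomial.C a * T n * (LaurentPolynomial.C b * T m) : k[X][T;T⁻¹]) =
      LaurentPolynomial.C (a * b) * T (n + m) := by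
  rw [map_mul, T_add]
  ring

theorem C_mul_T_pow (a : k[X]) (n : ℤ) (j : ℕ) :
    ((LaurentPolynomial.C a * T n) ^ j : k[X][T;T⁻¹]) =
      LaurentPolynomial.C (a ^ j) * T (j * n) := by
  rw [mul_pow, map_pow, T_pow]

/-- With `z = p T⁻ᵈ` a constant of `D`, one has `D y = z^(j+1) T^(d-1) b₁` and `d · D T = z^j p'
b₁`. Powers of `z` have degree zero, and the remaining degrees are incompatible. -/
theorem eq_zero_of_homogeneous_nilpotent_of_apply_eq_zero [CharZero k] {d : ℕ} (hd : 2 ≤ d)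
    {p : k[X]} (hp : 2 ≤ p.natDegree) {e : ℤ} {a b b₁ : k[X]} (j : ℕ) (hej : e = -(d * j + 1))
    (hb₁ : b = p ^ (j + 1) * b₁)
    (hTnil : ∃ N, (⇑(homogeneousDerivation e a b))^[N] (T 1) = 0)
    (hnil : ∀ g : k[X], ∃ N, (⇑(homogeneousDerivation e a b))^[N] (LaurentPolynomial.C g) = 0)
    (hDz : homogeneousDerivation e a b (LaurentPolynomial.C p * T (-d)) = 0) : a = 0 := by
  have : CharZero k[X][T;T⁻¹] := charZero_of_algebra (k := k)
  have hT : homogeneousDerivation e a b (T 1) = LaurentPolynomial.C a * T (1 + e) := by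
    simpa using homogeneousDerivation_C_mul_T e a b 1 1
  have hDC : ∀ c : k[X], homogeneousDerivation e a b (LaurentPolynomial.C c) =
      LaurentPolynomial.C (b * derivative c) * T e := by
    intro c
    simpa using homogeneousDerivation_C_mul_T e a b c 0
  have hp0 : p ≠ 0 := by rintro rfl; simp at hp
  by_contra ha0
  have hw0 : ((-d : ℤ) : k[X]) * a * p + b * derivative p = 0 := by
    rwa [homogeneousDerivation_C_mul_T, C_mul_T_eq_zero_iff] at hDz
  have hrel : (d : k[X]) * a = p ^ j * (derivative p * b₁) := by
    apply mul_right_cancel₀ hp0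
    rw [hb₁] at hw0
    push_cast at hw0
    linear_combination -hw0
  generalize homogeneousDerivation e a b = D at *
  obtain ⟨z, hzdef⟩ : ∃ z : k[X][T;T⁻¹], z = LaurentPolynomial.C p * T (-d) := ⟨_, rfl⟩
  have hz0 : z ≠ 0 := fun h => hp0 (C_mul_T_eq_zero_iff.1 (hzdef ▸ h))
  have hzdeg : HasDeg D z 0 := ⟨hz0, hzdef ▸ hDz⟩
  have hd0 : (d : k[X]) ≠ 0 := by exact_mod_cast (by omega : d ≠ 0)
  have hne : p ^ j * (derivative p * b₁) ≠ 0 := hrel ▸ mul_ne_zero hd0 ha0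
  have hp' : derivative p ≠ 0 := left_ne_zero_of_mul (right_ne_zero_of_mul hne)
  have hb0 : b₁ ≠ 0 := right_ne_zero_of_mul (right_ne_zero_of_mul hne)
  -- The bound `deg p ≥ 2` is essential here: it makes `p'` depend on `y`, so that its `D`-degree is
  -- at least that of `y`.
  have hp'' : derivative (derivative p) ≠ 0 := by
    intro h
    have h1 := derivative_eq_zero.1 h
    rw [natDegree_derivative] at h1
    omega
  have hC : ∀ c : k[X], c ≠ 0 → ∃ n, HasDeg D (LaurentPolynomial.C c) n := by
    intro c hc
    refine exists_hasDeg ?_ (hnil c)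
    simpa using (C_mul_T_eq_zero_iff (c := c) (n := 0)).not.2 hc
  obtain ⟨t, ht⟩ := exists_hasDeg (D := D) (f := T 1) (isUnit_T 1).ne_zero hTnil
  obtain ⟨s, hs⟩ := hC X X_ne_zero
  obtain ⟨q, hq⟩ := hC _ hp'
  obtain ⟨q', hq'⟩ := hC _ hp''
  obtain ⟨r, hr⟩ := hC _ hb0
  have hDy : D (LaurentPolynomial.C X) = LaurentPolynomial.C b * T e := by
    simpa using hDC X
  have hDy' : D (LaurentPolynomial.C X) = z ^ (j + 1) * (T 1 ^ (d - 1) * LaurentPolynomial.C b₁) := by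
    rw [hDy, hzdef, C_mul_T_pow, T_pow, hb₁, map_mul,
      show e = ((j + 1 : ℕ) : ℤ) * (-d) + ((d - 1 : ℕ) : ℤ) * 1 by
        rw [hej]; push_cast [show 1 ≤ d by omega]; ring, T_add]
    ring
  have hb00 : b ≠ 0 := hb₁ ▸ mul_ne_zero (pow_ne_zero _ hp0) hb0
  obtain ⟨s', rfl, hs'⟩ := hs.apply (by rw [hDy]; exact C_mul_T_eq_zero_iff.not.2 hb00)
  have e1 := hs'.unique (by
    rw [hDy']
    exact (hzdeg.pow (j + 1)).mul ((ht.pow (d - 1)).mul hr))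
  obtain ⟨t', rfl, ht'⟩ := ht.apply (by rw [hT]; exact C_mul_T_eq_zero_iff.not.2 ha0)
  have hddeg : HasDeg D (d : k[X][T;T⁻¹]) 0 :=
    ⟨Nat.cast_ne_zero.2 (by omega), by simp⟩
  have hDT : (d : k[X][T;T⁻¹]) * D (T 1) =
      z ^ j * (LaurentPolynomial.C (derivative p) * LaurentPolynomial.C b₁) := by
    have h1 : (d : k[X][T;T⁻¹]) = LaurentPolynomial.C (d : k[X]) := by simp
    rw [hT, hzdef, C_mul_T_pow, h1, ← mul_assoc, ← map_mul, hrel, ← map_mul, map_mul,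
      show 1 + e = j * (-d) by rw [hej]; ring]
    ring
  have e2 := (hddeg.mul ht').unique (by
    rw [hDT]
    exact (hzdeg.pow j).mul (hq.mul hr))
  have hDp : D (LaurentPolynomial.C (derivative p)) =
      LaurentPolynomial.C (derivative (derivative p)) * D (LaurentPolynomial.C X) := by
    rw [hDy, ← mul_assoc, ← map_mul, mul_comm _ b, hDC]
  obtain ⟨q₁, rfl, hq₁⟩ := hq.apply (by rw [hDp]; exact mul_ne_zero hq'.ne_zero hs'.ne_zero)
  have e3 := hq₁.unique (by
    rw [hDp]
    exact hq'.mul hs')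
  -- In `D`-degrees: `deg T > deg p' ≥ deg y > (d - 1) deg T ≥ deg T`, a contradiction.
  have e4 : 1 * (t' + 1) ≤ (d - 1) * (t' + 1) := Nat.mul_le_mul_right _ (by omega)
  simp only [mul_zero] at e1 e2
  omega

/-- A homogeneous locally nilpotent derivation of the graded ring spanned by the `pˡ g(y) Tⁿ`
with `n + d l ≥ 0` kills `T`. -/
theorem eq_zero_of_homogeneous_nilpotent [CharZero k] {d : ℕ} (hd : 2 ≤ d) {p : k[X]}
    (hp : 2 ≤ p.natDegree) {e : ℤ} {a b : k[X]}
    (hnil : ∀ (n : ℤ) (l : ℕ) (g : k[X]), 0 ≤ n + d * l →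
      ∃ N, (⇑(homogeneousDerivation e a b))^[N] (LaurentPolynomial.C (p ^ l * g) * T n) = 0)
    (ha : ∀ l : ℕ, 1 + e + d * l < d → p ^ l ∣ a) (hb : ∀ l : ℕ, e + d * l < d → p ^ l ∣ b)
    (hz : ∀ l : ℕ, -d + e + d * l < d → p ^ l ∣ ((-d : ℤ) : k[X]) * a * p + b * derivative p) :
    a = 0 := by
  have : CharZero k[X][T;T⁻¹] := charZero_of_algebra (k := k)
  set D := homogeneousDerivation e a b with hD
  have hp0 : p ≠ 0 := by rintro rfl; simp at hp
  have hT : D (T 1) = LaurentPolynomial.C a * T (1 + e) := by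
    simpa using homogeneousDerivation_C_mul_T e a b 1 1
  have hTnil : ∃ N, (⇑D)^[N] (T 1) = 0 := by simpa using hnil 1 0 1 (by simp)
  have key : ∀ (l : ℕ) (c : k[X]), 0 ≤ e + d * l → a = p ^ l * c → a = 0 := by
    intro l c hl hac
    -- Here `D T = T · (pˡ c Tᵉ)` with the cofactor in the graded ring, so `T` divides its own
    -- derivative there.
    have h1 := apply_eq_zero_of_eq_mul (D := D) hTnil (hnil e l c hl) (by
      rw [hT, hac, T_add]
      ring)
    rwa [hT, C_mul_T_eq_zero_iff] at h1
  by_contra ha0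
  rcases le_or_gt 0 e with he | he
  · exact ha0 (key 0 a (by simpa using he) (by simp))
  -- Divide `-e - 1` by `d`. For `i > 0` the divisibility of `a` still makes `T` divide `D T`; only
  -- `i = 0` needs the element `z`.
  obtain ⟨j, i, hi, hej⟩ : ∃ j i : ℕ, i < d ∧ e = -(d * j + i + 1) := by
    obtain ⟨m, hm⟩ := Int.eq_ofNat_of_zero_le (show 0 ≤ -e - 1 by omega)
    refine ⟨m / d, m % d, Nat.mod_lt _ (by omega), ?_⟩
    have h1 := Nat.div_add_mod m d
    zify at h1
    rw [← Int.natCast_ediv, ← Int.natCast_mod] at h1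
    linarith
  rcases Nat.eq_zero_or_pos i with rfl | hi0
  swap
  · obtain ⟨c, hc⟩ := ha (j + 1) (by push_cast; rw [hej]; ring_nf; omega)
    exact ha0 (key (j + 1) c (by push_cast; rw [hej]; ring_nf; omega) hc)
  obtain ⟨b₁, hb₁⟩ := hb (j + 1) (by push_cast; rw [hej]; ring_nf; omega)
  obtain ⟨w, hw⟩ := hz (j + 2) (by push_cast; rw [hej]; ring_nf; omega)
  have hej1 : 0 ≤ e + d * (j + 1 : ℕ) := by push_cast; rw [hej]; ring_nf; omega
  obtain ⟨z, hzdef⟩ : ∃ z : k[X][T;T⁻¹], z = LaurentPolynomial.C p * T (-d) := ⟨_, rfl⟩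
  have hznil : ∃ N, (⇑D)^[N] z = 0 := by
    rw [hzdef]
    simpa using hnil (-d) 1 1 (by simp)
  have hDz : D z = 0 := by
    refine apply_eq_zero_of_eq_mul hznil (hnil e (j + 1) w hej1) ?_
    rw [hD, hzdef, homogeneousDerivation_C_mul_T, hw, C_mul_T_mul]
    congr 2
    ring
  exact ha0 (eq_zero_of_homogeneous_nilpotent_of_apply_eq_zero hd hp j (by simpa using hej) hb₁ hTnil
    (fun g => by simpa using hnil 0 0 g (by simp)) (hzdef ▸ hDz))

end GradedDerivation

/-! ### Passing from a derivation of `B_{d,P}` to its leading part. -/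

section Extension

open LaurentPolynomial

variable {k : Type*} [Field k] {d : ℕ} {P : k[X][X]}

/-- The extension of a derivation of `B_{d,P}` to `k[y][x, x⁻¹]`. -/
def extendDerivation (δ : Derivation k (Surface d P) (Surface d P)) :
    Derivation k k[X][T;T⁻¹] k[X][T;T⁻¹] :=
  (toLaurentRing d P (δ (xCoord d P)) * T (-1)) • euler +
    toLaurentRing d P (δ (y₁ d P)) • coeffDeriv

/-- Agreement on `x` and `y₁` gives agreement on `xᵈ y₂ ∈ k[x, y]`, and then on `y₂` by cancelling
`xᵈ`. -/
theorem extendDerivation_toLaurentRing (δ : Derivation k (Surface d P) (Surface d P))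
    (b : Surface d P) :
    extendDerivation δ (toLaurentRing d P b) = toLaurentRing d P (δ b) := by
  let S : Subalgebra k (Surface d P) :=
    { carrier := {b | extendDerivation δ (toLaurentRing d P b) = toLaurentRing d P (δ b)}
      mul_mem' := by
        intro u v hu hv
        simp only [Set.mem_ofPred_eq] at hu hv ⊢
        simp only [map_mul, Derivation.leibniz, map_add, smul_eq_mul, hu, hv]
      add_mem' := by
        intro u v hu hv
        simp only [Set.mem_ofPred_eq] at hu hv ⊢
        simp only [map_add, hu, hv]
      algebraMap_mem' := by
        intro r
        simp only [Set.mem_ofPred_eq, AlgHom.commutes, Derivation.map_algebraMap, map_zero] }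
  have hx : xCoord d P ∈ S := by
    change extendDerivation δ (toLaurentRing d P (xCoord d P)) = _
    have h1 : euler (T 1 : k[X][T;T⁻¹]) = T 1 := by simpa using euler_C_mul_T (1 : k[X]) 1
    have h2 : coeffDeriv (T 1 : k[X][T;T⁻¹]) = 0 := by simpa using coeffDeriv_C_mul_T (1 : k[X]) 1
    rw [toLaurentRing_xCoord, extendDerivation, Derivation.add_apply, Derivation.smul_apply,
      Derivation.smul_apply, h1, h2, smul_zero, add_zero, smul_eq_mul, mul_assoc, ← T_add]
    simp
  have hy : y₁ d P ∈ S := by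
    change extendDerivation δ (toLaurentRing d P (y₁ d P)) = _
    have h1 : euler (LaurentPolynomial.C X : k[X][T;T⁻¹]) = 0 := by
      simpa using euler_C_mul_T (X : k[X]) 0
    have h2 : coeffDeriv (LaurentPolynomial.C X : k[X][T;T⁻¹]) = 1 := by
      simpa using coeffDeriv_C_mul_T (X : k[X]) 0
    rw [toLaurentRing_y₁, extendDerivation, Derivation.add_apply, Derivation.smul_apply,
      Derivation.smul_apply, h1, h2, smul_zero, zero_add, smul_eq_mul, mul_one]
  have hS : ∀ g : k[X][X], toSurface d P g ∈ S := by
    intro g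
    induction g using Polynomial.induction_on' with
    | add u v hu hv => rw [map_add]; exact add_mem hu hv
    | monomial n c =>
      rw [← C_mul_X_pow_eq_monomial, map_mul, map_pow, toSurface_X, toSurface_C]
      exact mul_mem (Algebra.adjoin_le (by simpa using hy) (aeval_mem_adjoin_singleton k _))
        (pow_mem hx n)
  have hy₂ : y₂ d P ∈ S := by
    have h1 : xCoord d P ^ d ∈ S := pow_mem hx d
    have h2 : xCoord d P ^ d * y₂ d P ∈ S := xCoord_pow_mul_y₂ d P ▸ hS _
    change extendDerivation δ (toLaurentRing d P _) = toLaurentRing d P (δ _) at h1 h2 ⊢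
    rw [map_mul, Derivation.leibniz, Derivation.leibniz, h1, map_add, smul_eq_mul, smul_eq_mul,
      smul_eq_mul, smul_eq_mul, map_mul, map_mul, add_left_inj] at h2
    refine mul_left_cancel₀ ?_ h2
    rw [map_pow, toLaurentRing_xCoord]
    exact pow_ne_zero _ (isUnit_T 1).ne_zero
  obtain ⟨Q, rfl⟩ := exists_eval₂_eq d P b
  have : Q.eval₂ (toSurface d P).toRingHom (y₂ d P) ∈ S := by
    rw [eval₂_eq_sum_range]
    exact sum_mem fun i _ => mul_mem (hS _) (pow_mem hy₂ i)
  exact this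

theorem HasLead.extendDerivation {δ : Derivation k (Surface d P) (Surface d P)} {e : ℤ}
    {a b : k[X]} (ha : HasLead (1 + e) (toLaurentRing d P (δ (xCoord d P))) a)
    (hb : HasLead e (toLaurentRing d P (δ (y₁ d P))) b) {n : ℤ} {f : Surface d P} {c : k[X]}
    (hf : HasLead n (toLaurentRing d P f) c) :
    HasLead (n + e) (toLaurentRing d P (δ f)) (n * a * c + b * derivative c) := by
  rw [← extendDerivation_toLaurentRing, Danielewski.extendDerivation, Derivation.add_apply,
    Derivation.smul_apply, Derivation.smul_apply]
  have h1 := (ha.mul (hasLead_T (-1))).mul hf.euler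
  have h2 := hb.mul hf.coeffDeriv
  rw [show 1 + e + -1 + n = n + e by ring] at h1
  rw [add_comm e n] at h2
  simp only [smul_eq_mul]
  convert h1.add h2 using 1
  ring

/-- Transfers nilpotency: once an iterate of `δ` kills `f`, the same iterate of the leading part
kills the leading form of `f`. -/
theorem HasLead.iterate {δ : Derivation k (Surface d P) (Surface d P)} {e : ℤ}
    {a b : k[X]} (ha : HasLead (1 + e) (toLaurentRing d P (δ (xCoord d P))) a)
    (hb : HasLead e (toLaurentRing d P (δ (y₁ d P))) b) (N : ℕ) : ∀ {n : ℤ} {f : Surface d P}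
    {c : k[X]}, HasLead n (toLaurentRing d P f) c → ∃ c' n',
      HasLead n' (toLaurentRing d P ((⇑δ)^[N] f)) c' ∧
      (⇑(homogeneousDerivation e a b))^[N] (LaurentPolynomial.C c * T n) =
        LaurentPolynomial.C c' * T n' := by
  induction N with
  | zero => exact fun {n f c} h => ⟨c, n, h, rfl⟩
  | succ N ih =>
    intro n f c h
    obtain ⟨c', n', h1, h2⟩ := ih (ha.extendDerivation hb h)
    refine ⟨c', n', h1, ?_⟩
    rw [Function.iterate_succ_apply, homogeneousDerivation_C_mul_T, h2]

theorem exists_hasLead_pow_mul (n : ℤ) (l : ℕ) (g : k[X]) (h : 0 ≤ n + d * l) :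
    ∃ f : Surface d P, HasLead n (toLaurentRing d P f)
      (P.map (evalRingHom (0 : k)) ^ l * g) := by
  obtain ⟨m, hm⟩ := Int.eq_ofNat_of_zero_le h
  refine ⟨y₂ d P ^ l * toSurface d P (Polynomial.C g * X ^ m), ?_⟩
  have h1 := (hasLead_T (k := k) (-d)).mul (hasLead_toLaurent (swapVars P))
  rw [← toLaurentRing_y₂, coeff_zero_swapVars, one_mul, add_zero] at h1
  have h2 := hasLead_C_mul_T g m
  rw [← Polynomial.toLaurent_C_mul_X_pow, ← toLaurentRing_toSurface d P] at h2
  rw [map_mul, map_pow]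
  convert (h1.pow l).mul h2 using 1
  linear_combination hm

/-- Take `e` to be the smaller of `ord u - 1` and `ord v`; the shift by one reflects that `x` itself
has order one. -/
theorem exists_common_hasLead {u v : k[X][T;T⁻¹]} (h : u ≠ 0) :
    ∃ e a b, (a ≠ 0 ∨ b ≠ 0) ∧ HasLead (1 + e) u a ∧ HasLead e v b := by
  obtain ⟨n, a, ha, hu⟩ := exists_hasLead h
  by_cases hv : v = 0
  · exact ⟨n - 1, a, 0, .inl ha, by rwa [add_sub_cancel], hv ▸ hasLead_zero _⟩
  obtain ⟨m, b, hb, hv⟩ := exists_hasLead hv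
  rcases lt_trichotomy n (1 + m) with h | rfl | h
  · exact ⟨n - 1, a, 0, .inl ha, by rwa [add_sub_cancel], hv.of_lt (by omega)⟩
  · exact ⟨m, a, b, .inl ha, hu, hv⟩
  · exact ⟨m, 0, b, .inr hb, hu.of_lt h, hv⟩

end Extension

/-! ### Slices and conjugate derivations. -/

section Kernel

variable {k : Type*} [Field k]

theorem exists_derivative_eq [CharZero k] (q : k[X]) : ∃ Q : k[X], derivative Q = q := by
  induction q using Polynomial.induction_on' with
  | add u v hu hv =>
    obtain ⟨U, rfl⟩ := hu
    obtain ⟨V, rfl⟩ := hv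
    exact ⟨U + V, derivative_add⟩
  | monomial n c =>
    refine ⟨monomial (n + 1) (c / (n + 1)), ?_⟩
    have : (n + 1 : k) ≠ 0 := by exact_mod_cast n.succ_ne_zero
    rw [derivative_monomial]
    push_cast
    rw [div_mul_cancel₀ _ this]

/-- Integrate along the slice: if `δ f = q(s)` and `Q' = q`, then `f - Q(s)` lies in the kernel,
hence is a scalar. -/
theorem exists_aeval_eq [CharZero k] {B : Type*} [CommRing B] [Algebra k B] {δ : Derivation k B B} {s : B}
    (hs : δ s = 1) (hker : ∀ f, δ f = 0 → ∃ c : k, f = algebraMap k B c) (N : ℕ) :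
    ∀ f : B, (⇑δ)^[N] f = 0 → ∃ q : k[X], f = aeval s q := by
  induction N with
  | zero => exact fun f hf => ⟨0, by simpa using hf⟩
  | succ N ih =>
    intro f hf
    obtain ⟨q, hq⟩ := ih (δ f) hf
    obtain ⟨Q, rfl⟩ := exists_derivative_eq q
    obtain ⟨c, hc⟩ := hker (f - aeval s Q) (by simp [hq, hs])
    exact ⟨Q + Polynomial.C c, by rw [map_add, aeval_C, ← hc]; ring⟩

/-- The conjugate `α⁻¹ δ α` of a derivation by an automorphism. -/
def conjDerivation {B : Type*} [CommRing B] [Algebra k B] (δ : Derivation k B B) (α : B ≃ₐ[k] B) :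
    Derivation k B B :=
  Derivation.mk' (α.symm.toLinearMap ∘ₗ δ.toLinearMap ∘ₗ α.toLinearMap) fun a b => by
    simp

theorem conjDerivation_apply {B : Type*} [CommRing B] [Algebra k B] (δ : Derivation k B B)
    (α : B ≃ₐ[k] B) (b : B) : conjDerivation δ α b = α.symm (δ (α b)) := rfl

theorem IsLocallyNilpotent.conjDerivation {B : Type*} [CommRing B] [Algebra k B]
    {δ : Derivation k B B} (hδ : IsLocallyNilpotent δ) (α : B ≃ₐ[k] B) :
    IsLocallyNilpotent (conjDerivation δ α) := by
  intro b
  obtain ⟨n, hn⟩ := hδ (α b)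
  refine ⟨n, ?_⟩
  have : ∀ n, (⇑(Danielewski.conjDerivation δ α))^[n] b = α.symm ((⇑δ)^[n] (α b)) := by
    intro n
    induction n with
    | zero => simp
    | succ n ih =>
      rw [Function.iterate_succ_apply', Function.iterate_succ_apply', ih, conjDerivation_apply,
        AlgEquiv.apply_symm_apply]
  rw [this, hn, map_zero]

end Kernel

/-! ### Locally nilpotent derivations kill `x`, and the consequences. -/

section MakarLimanov

open LaurentPolynomial

variable {k : Type*} [Field k] {d : ℕ} {P : k[X][X]}

/-- Otherwise the last nonzero iterate of `δ` on `x` is a scalar, which yields a slice `s` and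
`B_{d,P} = k[s]`. This is too small to contain the algebraically independent `x` and `y₁`. -/
theorem exists_nonconstant_mem_ker [CharZero k] (hp : P.map (evalRingHom (0 : k)) ≠ 0)
    {δ : Derivation k (Surface d P) (Surface d P)} (hδ : IsLocallyNilpotent δ)
    (hx : δ (xCoord d P) ≠ 0) : ∃ f, δ f = 0 ∧ ∀ c : k, f ≠ algebraMap k _ c := by
  have := isDomain_surface (d := d) hp
  by_contra! hker
  obtain ⟨n, hn⟩ := exists_hasDeg (D := δ) (f := xCoord d P) (by rintro h; simp [h] at hx) (hδ _)
  rcases n with _ | n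
  · exact hx hn.2
  obtain ⟨c, hc⟩ := hker _ ((Function.iterate_succ_apply' (⇑δ) (n + 1) _).symm.trans hn.2)
  have hc0 : c ≠ 0 := by
    rintro rfl
    exact hn.1 (by rw [hc, map_zero])
  obtain ⟨s, hs⟩ : ∃ s, δ s = 1 := by
    refine ⟨algebraMap k _ c⁻¹ * (⇑δ)^[n] (xCoord d P), ?_⟩
    rw [Derivation.leibniz, Derivation.map_algebraMap, smul_zero, add_zero, smul_eq_mul,
      ← Function.iterate_succ_apply' (⇑δ), hc, ← map_mul, inv_mul_cancel₀ hc0, map_one]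
  have key : ∀ f, ∃ q : k[X], f = aeval s q := fun f => by
    obtain ⟨N, hN⟩ := hδ f
    exact exists_aeval_eq hs hker N f hN
  obtain ⟨u, hu⟩ := key (xCoord d P)
  obtain ⟨v, hv⟩ := key (y₁ d P)
  have hu' := congrArg (toLaurentRing d P) hu
  have hv' := congrArg (toLaurentRing d P) hv
  rw [toLaurentRing_xCoord, ← aeval_algHom_apply] at hu'
  rw [toLaurentRing_y₁, ← aeval_algHom_apply] at hv'
  have h1 : euler (T 1 : k[X][T;T⁻¹]) = T 1 := by simpa using euler_C_mul_T (1 : k[X]) 1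
  have h2 : coeffDeriv (T 1 : k[X][T;T⁻¹]) = 0 := by simpa using coeffDeriv_C_mul_T (1 : k[X]) 1
  have h3 : coeffDeriv (LaurentPolynomial.C X : k[X][T;T⁻¹]) = 1 := by
    simpa using coeffDeriv_C_mul_T (X : k[X]) 0
  rw [hu', Derivation.map_aeval, ← hu', smul_eq_mul] at h1
  rw [hu', Derivation.map_aeval, smul_eq_mul] at h2
  rw [hv', Derivation.map_aeval, smul_eq_mul] at h3
  have hT : (T 1 : k[X][T;T⁻¹]) ≠ 0 := (isUnit_T 1).ne_zero
  -- From `x = u(s)`, `∂x/∂y = 0` gives `u'(s) = 0` or `∂s/∂y = 0`; these contradict `x ∂x/∂x = x`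
  -- and `∂y/∂y = 1` respectively.
  rcases mul_eq_zero.1 h2 with h | h
  · rw [h, zero_mul] at h1
    exact hT h1.symm
  · rw [h, mul_zero] at h3
    exact zero_ne_one h3

/-- Every locally nilpotent derivation of `B_{d,P}` kills `x`. -/
theorem IsLocallyNilpotent.apply_xCoord [CharZero k] (hd : 2 ≤ d)
    (hP : 2 ≤ (P.map (evalRingHom (0 : k))).natDegree)
    {δ : Derivation k (Surface d P) (Surface d P)} (hδ : IsLocallyNilpotent δ) :
    δ (xCoord d P) = 0 := by
  by_contra hx
  have hp : P.map (evalRingHom (0 : k)) ≠ 0 := by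
    intro h
    simp [h] at hP
  have := isDomain_surface (d := d) hp
  have : CharZero (Surface d P) := charZero_of_algebra (k := k)
  have hinj := toLaurentRing_injective (d := d) hp
  obtain ⟨e, a, b, hab, ha, hb⟩ := exists_common_hasLead (v := toLaurentRing d P (δ (y₁ d P)))
    ((map_ne_zero_iff _ hinj).2 hx)
  have hz : HasLead (-d) (toLaurentRing d P (y₂ d P)) (P.map (evalRingHom (0 : k))) := by
    have h1 := (hasLead_T (k := k) (-d)).mul (hasLead_toLaurent (swapVars P))
    rwa [← toLaurentRing_y₂, coeff_zero_swapVars, one_mul, add_zero] at h1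
  have ha0 : a = 0 := by
    refine eq_zero_of_homogeneous_nilpotent hd hP (e := e) (b := b) (fun n l g hn => ?_)
      (fun l hl => pow_dvd_of_hasLead hp ha l hl) (fun l hl => pow_dvd_of_hasLead hp hb l hl)
      (fun l hl => ?_)
    · obtain ⟨f, hf⟩ := exists_hasLead_pow_mul n l g hn
      obtain ⟨N, hN⟩ := hδ f
      obtain ⟨c', n', h1, h2⟩ := HasLead.iterate ha hb N hf
      refine ⟨N, h2.trans (C_mul_T_eq_zero_iff.2 ?_)⟩
      rw [hN, map_zero] at h1
      exact h1.unique (hasLead_zero _)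
    · exact pow_dvd_of_hasLead hp (ha.extendDerivation hb hz) l hl
  have hb0 : b ≠ 0 := hab.resolve_left (not_not.2 ha0)
  obtain ⟨f, hf, hfc⟩ := exists_nonconstant_mem_ker hp hδ hx
  have hf0 : f ≠ 0 := fun h => hfc 0 (by rw [h, map_zero])
  obtain ⟨n, c, hc, hfl⟩ := exists_hasLead ((map_ne_zero_iff _ hinj).2 hf0)
  have hc' : derivative c = 0 := by
    have h1 := ha.extendDerivation hb hfl
    rw [hf, map_zero, ha0, mul_zero, zero_mul, zero_add] at h1
    exact (mul_eq_zero.1 (h1.unique (hasLead_zero _))).resolve_left hb0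
  rw [derivative_eq_zero] at hc'
  -- A negative order would make `p`, of degree at least 2, divide the nonzero constant `c`.
  have hn : 0 ≤ n := by
    by_contra! hn
    have h1 := pow_dvd_of_hasLead hp hfl 1 (by simpa using hn)
    rw [pow_one] at h1
    have := natDegree_le_of_dvd h1 hc
    omega
  obtain ⟨m, rfl⟩ := Int.eq_ofNat_of_zero_le hn
  obtain ⟨g, hg, hgc⟩ := hfl
  obtain ⟨r, hr⟩ : ∃ r : k, (X ^ m * g).coeff 0 = Polynomial.C r := by
    rw [mul_coeff_zero, hgc, eq_C_of_natDegree_eq_zero hc', coeff_X_pow]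
    split_ifs
    · exact ⟨c.coeff 0, one_mul _⟩
    · exact ⟨0, by simp⟩
  have hfg : f = toSurface d P (X ^ m * g) :=
    eq_toSurface hp (by rw [hg, map_mul, Polynomial.toLaurent_X_pow])
  have hmul : f - algebraMap k _ r = xCoord d P * toSurface d P (divX (X ^ m * g)) := by
    rw [hfg]
    conv_lhs => rw [← X_mul_divX_add (X ^ m * g), hr, map_add, map_mul, toSurface_X]
    rw [toSurface_C, aeval_C, add_sub_cancel_right]
  refine hx (apply_eq_zero_of_mul (hδ _) (hδ (toSurface d P (divX (X ^ m * g)))) ?_ ?_)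
  · rw [← hmul]
    exact sub_ne_zero.2 (hfc r)
  · rw [← hmul, map_sub, hf, Derivation.map_algebraMap, sub_zero]

theorem derivation_apply_eq (Δ : Derivation k (Surface d P) (Surface d P))
    (hx : Δ (xCoord d P) = 0) (b : Surface d P) :
    toLaurentRing d P (Δ b) =
      toLaurentRing d P (Δ (y₁ d P)) * coeffDeriv (toLaurentRing d P b) := by
  rw [← extendDerivation_toLaurentRing, extendDerivation, hx]
  simp

theorem derivation_eq_zero_tfae [CharZero k] (hP : 2 ≤ (P.map (evalRingHom (0 : k))).natDegree)
    (Δ : Derivation k (Surface d P) (Surface d P)) (hx : Δ (xCoord d P) = 0) :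
    [∀ b, Δ b = 0, Δ (y₁ d P) = 0, Δ (y₂ d P) = 0].TFAE := by
  have hp : P.map (evalRingHom (0 : k)) ≠ 0 := by
    intro h
    simp [h] at hP
  have hinj := toLaurentRing_injective (d := d) hp
  tfae_have 1 → 3 := fun h => h _
  tfae_have 3 → 2 := by
    intro h
    have h1 := derivation_apply_eq Δ hx (y₂ d P)
    rw [h, map_zero, eq_comm, mul_eq_zero] at h1
    refine (map_eq_zero_iff _ hinj).1 (h1.resolve_right fun h2 => ?_)
    have h3 := ((hasLead_T (k := k) (-d)).mul (hasLead_toLaurent (swapVars P))).coeffDeriv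
    rw [← toLaurentRing_y₂, h2, coeff_zero_swapVars, one_mul] at h3
    have h4 := derivative_eq_zero.1 (h3.unique (hasLead_zero _))
    omega
  tfae_have 2 → 1 := by
    intro h b
    have h1 := derivation_apply_eq Δ hx b
    rw [h, map_zero, zero_mul] at h1
    exact (map_eq_zero_iff _ hinj).1 h1
  tfae_finish

end MakarLimanov

end Danielewski

end

theorem lemma4p4 {k : Type*} [Field k] [CharZero k] (d : ℕ) (hd : 2 ≤ d) (P : k[X][X])
    (hP : 2 ≤ (P.map (Polynomial.evalRingHom (0 : k))).natDegree)
    (δ : Derivation k (Danielewski.Surface d P) (Danielewski.Surface d P))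
    (hδ : Danielewski.IsLocallyNilpotent δ)
    (α : Danielewski.Surface d P ≃ₐ[k] Danielewski.Surface d P) :
    (α ∈ Danielewski.isotropySubgroup δ ↔
      δ (α (Danielewski.y₁ d P)) = α (δ (Danielewski.y₁ d P))) ∧
    (α ∈ Danielewski.isotropySubgroup δ ↔
      δ (α (Danielewski.y₂ d P)) = α (δ (Danielewski.y₂ d P))) := by
  have hx := hδ.apply_xCoord hd hP
  have hx' := (hδ.conjDerivation α).apply_xCoord hd hP
  -- The difference need not be locally nilpotent; it kills `x` because both terms do.
  have H := Danielewski.derivation_eq_zero_tfae hP (Danielewski.conjDerivation δ α - δ)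
    (by rw [Derivation.sub_apply, hx, hx', sub_zero])
  have hΔ : ∀ b, (Danielewski.conjDerivation δ α - δ) b = 0 ↔ δ (α b) = α (δ b) := by
    intro b
    rw [Derivation.sub_apply, sub_eq_zero, Danielewski.conjDerivation_apply,
      AlgEquiv.symm_apply_eq]
  have hmem : α ∈ Danielewski.isotropySubgroup δ ↔
      ∀ b, (Danielewski.conjDerivation δ α - δ) b = 0 := by
    simp only [hΔ]
    exact forall_congr' fun b => eq_comm
  rw [hmem, ← hΔ, ← hΔ]
  exact ⟨H.out 0 1, H.out 0 2⟩
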